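/- Let $M$ be a connected smooth manifold of (finite) dimension greater than $2$ and let $\omega$ be a locally conformally symplectic (lcs) form on $M$: a smooth non-degenerate $2$-form such that every point has an open neighbourhood $U$ and a smooth function $f_U:U\to\mathbb R$ with $d(e^{-f_U}\omega)=0$ on $U$. Let $\theta$ be its Lee form, i.e. the closed $1$-form with $\theta|_U=df_U$. A presentation of $(M,\omega)$ consists of a symplectic manifold $(M_0,\omega_0)$, a discrete group $\Gamma$ acting smoothly, freely and properly on $M_0$ with $M_0/\Gamma=M$ and projection $p:M_0\to M$, a homomorphism $\rho:\Gamma\to\mathbb R$ and a smooth function $\lambda:M_0\to\mathbb R$ such that $\gamma^*\omega_0=e^{-\rho(\gamma)}\omega_0$ and $\lambda\circ\gamma-\lambda=\rho(\gamma)$ for all $\gamma\in\Gamma$, $p^*\omega=e^{\lambda}\omega_0$ and $p^*\theta=d\lambda$. A vector field $X$ on $M$ is special lcs if its lift $X_0$ to a (equivalently, any) presentation satisfies $\mathcal L_{X_0}\omega_0=0$. A smooth action of a Lie group $G$ on $M$ is special lcs if the fundamental vector field of every element of the Lie algebra of $G$ is special lcs. Let $\pi:\tilde M\to M$ be the universal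 covering, $\tilde\lambda$ a primitive of $\pi^*\theta$, and $\Gamma_0$ the group of the deck transformations $\gamma$ of $\pi$ with $\tilde\lambda\circ\gamma=\tilde\lambda$. The minimal covering is $\hat M=\tilde M/\Gamma_0$ with the induced covering $p:\hat M\to M$; on it let $\lambda$ be a primitive of $p^*\theta$ and let $\omega_0=e^{-\lambda}p^*\omega$, a symplectic form. Let $G$ be a connected Lie group with a smooth special lcs action on $(M,\omega)$. Then this action lifts to a symplectic action of $G$ on $(\hat M,\omega_0)$: there is a smooth action of $G$ on $\hat M$ such that $p(g\cdot x)=g\cdot p(x)$ and $g^*\omega_0=\omega_0$ for all $g\in G$ and $x\in\hat M$. -/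

import Mathlib

open scoped Manifold ContDiff

noncomputable section

namespace LCS

universe u

/-! Manifolds here are finite-dimensional real `C^∞` manifolds without boundary, modelled on a
normed space `E` with the model `𝓘(ℝ, E)`. -/

section Forms

variable {E : Type*} [NormedAddCommGroup E] [NormedSpace ℝ E]
  {M : Type*} [TopologicalSpace M] [ChartedSpace E M]
  {N : Type*} [TopologicalSpace N] [ChartedSpace E N]

/-- (Not necessarily smooth) differential `k`-forms on `M`. -/
abbrev DForm (E : Type*) [NormedAddCommGroup E] [NormedSpace ℝ E]
    (M : Type*) [TopologicalSpace M] [ChartedSpace E M] (k : ℕ) : Type _ :=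
  ∀ x : M, TangentSpace 𝓘(ℝ, E) x [⋀^Fin k]→L[ℝ] ℝ

/-- `1`-forms, as families of linear functionals on the tangent spaces. -/
abbrev OneForm (E : Type*) [NormedAddCommGroup E] [NormedSpace ℝ E]
    (M : Type*) [TopologicalSpace M] [ChartedSpace E M] : Type _ :=
  ∀ x : M, TangentSpace 𝓘(ℝ, E) x →L[ℝ] ℝ

/-- The pullback `f^* η` of a differential form. -/
def pullback {k : ℕ} (f : N → M) (η : DForm E M k) : DForm E N k :=
  fun y => (η (f y)).compContinuousLinearMap (mfderiv 𝓘(ℝ, E) 𝓘(ℝ, E) f y)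

/-- The expression of a form in the preferred chart at `x₀`: the pullback by the inverse of the
chart. Only its values on the target of the chart are meaningful. -/
def formInChart {k : ℕ} (η : DForm E M k) (x₀ : M) : E → E [⋀^Fin k]→L[ℝ] ℝ :=
  fun y => (η ((chartAt E x₀).symm y)).compContinuousLinearMap
    (mfderiv 𝓘(ℝ, E) 𝓘(ℝ, E) (chartAt E x₀).symm y)

/-- The expression of a vector field in the preferred chart at `x₀`. -/
def fieldInChart (X : ∀ x : M, TangentSpace 𝓘(ℝ, E) x) (x₀ : M) : E → E :=
  fun y => VectorField.mpullback 𝓘(ℝ, E) 𝓘(ℝ, E) (chartAt E x₀).symm X y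

/-- Smooth differential forms. -/
def SmoothForm {k : ℕ} (η : DForm E M k) : Prop :=
  ∀ x₀ : M, ContDiffOn ℝ ∞ (formInChart η x₀) (chartAt E x₀).target

/-- `dη = 0` on the (open) set `U`. -/
def ClosedOn {k : ℕ} (η : DForm E M k) (U : Set M) : Prop :=
  ∀ x₀ : M, ∀ y ∈ (chartAt E x₀).target, (chartAt E x₀).symm y ∈ U →
    extDeriv (formInChart η x₀) y = 0

/-- The Lie derivative `L_V η` of a `k`-form along a vector field on a vector space, evaluated
at `y` on `v₁, …, v_k`:
`(D_V η)(v₁, …, v_k) + ∑ᵢ η(v₁, …, D_{vᵢ} V, …, v_k)`. -/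
def lieDerivE {k : ℕ} (V : E → E) (η : E → E [⋀^Fin k]→L[ℝ] ℝ) (y : E) (v : Fin k → E) : ℝ :=
  fderiv ℝ η y (V y) v + ∑ i, η y (Function.update v i (fderiv ℝ V y (v i)))

/-- `L_X η = 0` on `M`. -/
def LieDerivZero {k : ℕ} (X : ∀ x : M, TangentSpace 𝓘(ℝ, E) x) (η : DForm E M k) : Prop :=
  ∀ x₀ : M, ∀ y ∈ (chartAt E x₀).target, ∀ v : Fin k → E,
    lieDerivE (fieldInChart X x₀) (formInChart η x₀) y v = 0

/-- Non-degenerate `2`-forms. -/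
def Nondegenerate (Ω : DForm E M 2) : Prop :=
  ∀ (x : M) (v : TangentSpace 𝓘(ℝ, E) x),
    (∀ w : TangentSpace 𝓘(ℝ, E) x, Ω x ![v, w] = 0) → v = 0

/-- Symplectic forms. -/
structure IsSymplectic (Ω : DForm E M 2) : Prop where
  smooth : SmoothForm Ω
  nondegenerate : Nondegenerate Ω
  closed : ClosedOn Ω Set.univ

/-- The form `e^{-f} η`. -/
def conf {k : ℕ} (f : M → ℝ) (η : DForm E M k) : DForm E M k :=
  fun x => Real.exp (-f x) • η x

/-- Locally conformally symplectic forms on a manifold of dimension greater than `2`. -/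
structure IsLCS (Ω : DForm E M 2) : Prop where
  two_lt_dim : 2 < Module.finrank ℝ E
  smooth : SmoothForm Ω
  nondegenerate : Nondegenerate Ω
  locally_conformal : ∀ x : M, ∃ U : Set M, IsOpen U ∧ x ∈ U ∧ ∃ f : M → ℝ,
    ContMDiffOn 𝓘(ℝ, E) 𝓘(ℝ) ∞ f U ∧ ClosedOn (conf f Ω) U

/-- `θ` is the Lee form of `Ω`: the `1`-form obtained by gluing the differentials `df` of the
local functions `f` such that `e^{-f} Ω` is closed. -/
def IsLeeForm (Ω : DForm E M 2) (θ : OneForm E M) : Prop :=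
  ∀ x : M, ∃ U : Set M, IsOpen U ∧ x ∈ U ∧ ∃ f : M → ℝ,
    ContMDiffOn 𝓘(ℝ, E) 𝓘(ℝ) ∞ f U ∧ ClosedOn (conf f Ω) U ∧
    ∀ z ∈ U, θ z = mfderiv 𝓘(ℝ, E) 𝓘(ℝ) f z

/-- `lam` is a smooth primitive of `p^* θ`. -/
structure IsPrimitive (p : N → M) (θ : OneForm E M) (lam : N → ℝ) : Prop where
  smooth : ContMDiff 𝓘(ℝ, E) 𝓘(ℝ) ∞ lam
  deriv_eq : ∀ y : N, mfderiv 𝓘(ℝ, E) 𝓘(ℝ) lam y =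
    (θ (p y)).comp (mfderiv 𝓘(ℝ, E) 𝓘(ℝ, E) p y)

end Forms

section Presentations

variable {E : Type*} [NormedAddCommGroup E] [NormedSpace ℝ E]

/-- `(M₀, Ω₀, Γ, ρ, lam)`, with projection `p : M₀ → M`, is a presentation of the lcs structure
`(Ω, θ)` on `M`: the discrete group `Γ` acts smoothly, freely and properly on `M₀` with quotient
manifold `M`, by symplectic homotheties `γ^* Ω₀ = e^{-ρ(γ)} Ω₀`, and `lam` is `ρ`-equivariant with
`p^* Ω = e^{lam} Ω₀` and `p^* θ = d lam`. -/
structure IsPresentation {M : Type*} [TopologicalSpace M] [ChartedSpace E M]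
    (Ω : DForm E M 2) (θ : OneForm E M)
    {M₀ : Type*} [TopologicalSpace M₀] [ChartedSpace E M₀]
    (p : M₀ → M) (Ω₀ : DForm E M₀ 2)
    (Γ : Type*) [Group Γ] [MulAction Γ M₀] (ρ : Γ →* Multiplicative ℝ) (lam : M₀ → ℝ) :
    Prop where
  symplectic : IsSymplectic Ω₀
  smooth_action : ∀ γ : Γ, ContMDiff 𝓘(ℝ, E) 𝓘(ℝ, E) ∞ (fun x : M₀ => γ • x)
  free : ∀ (γ : Γ) (x : M₀), γ • x = x → γ = 1
  proper : ProperlyDiscontinuousSMul Γ M₀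
  surjective : Function.Surjective p
  fibers : ∀ a b : M₀, p a = p b ↔ ∃ γ : Γ, γ • a = b
  local_diffeo : IsLocalDiffeomorph 𝓘(ℝ, E) 𝓘(ℝ, E) ∞ p
  homothety : ∀ γ : Γ,
    pullback (fun x : M₀ => γ • x) Ω₀ = fun x => Real.exp (-(ρ γ).toAdd) • Ω₀ x
  equivariant : ∀ (γ : Γ) (x : M₀), lam (γ • x) - lam x = (ρ γ).toAdd
  primitive : IsPrimitive p θ lam
  form_eq : pullback p Ω = fun x => Real.exp (lam x) • Ω₀ x

/-- A vector field on an lcs manifold is special lcs if its lift to a presentation is an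
infinitesimal symplectomorphism. -/
def IsSpecialField {M : Type u} [TopologicalSpace M] [ChartedSpace E M]
    (Ω : DForm E M 2) (θ : OneForm E M) (X : ∀ x : M, TangentSpace 𝓘(ℝ, E) x) : Prop :=
  ∃ (M₀ : Type u) (_ : TopologicalSpace M₀) (_ : ChartedSpace E M₀)
    (_ : IsManifold 𝓘(ℝ, E) ∞ M₀) (_ : T2Space M₀) (_ : SecondCountableTopology M₀)
    (p : M₀ → M) (Ω₀ : DForm E M₀ 2) (Γ : Type u) (_ : Group Γ) (_ : MulAction Γ M₀)
    (ρ : Γ →* Multiplicative ℝ) (lam : M₀ → ℝ),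
    IsPresentation Ω θ p Ω₀ Γ ρ lam ∧
    LieDerivZero (VectorField.mpullback 𝓘(ℝ, E) 𝓘(ℝ, E) p X) Ω₀

end Presentations

section Coverings

variable {E : Type*} [NormedAddCommGroup E] [NormedSpace ℝ E]

/-- Smooth covering maps. -/
structure IsSmoothCovering {N M : Type*} [TopologicalSpace N] [ChartedSpace E N]
    [TopologicalSpace M] [ChartedSpace E M] (p : N → M) : Prop where
  covering : IsCoveringMap p
  surjective : Function.Surjective p
  local_diffeo : IsLocalDiffeomorph 𝓘(ℝ, E) 𝓘(ℝ, E) ∞ p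

/-- For the universal covering `π : Mt → M` and a primitive `lam` of `π^* θ`, the kernel `Γ₀` of
the homomorphism `γ ↦ lam ∘ γ - lam` on the group of deck transformations of `π`. -/
def homothetyKernel {Mt M : Type*} [TopologicalSpace Mt] (π : Mt → M) (lam : Mt → ℝ) :
    Subgroup (Mt ≃ₜ Mt) where
  carrier := {γ | (∀ x, π (γ x) = π x) ∧ ∀ x, lam (γ x) - lam x = 0}
  one_mem' := ⟨fun _ => rfl, fun _ => sub_self _⟩
  mul_mem' {a b} ha hb :=
    ⟨fun x => (ha.1 (b x)).trans (hb.1 x), fun x => by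
      have h₁ := ha.2 (b x)
      have h₂ := hb.2 x
      change lam (a (b x)) - lam x = 0
      linarith⟩
  inv_mem' {a} ha :=
    ⟨fun x => by
      have h := ha.1 (a.symm x)
      rw [a.apply_symm_apply] at h
      exact h.symm, fun x => by
      have h := ha.2 (a.symm x)
      rw [a.apply_symm_apply] at h
      change lam (a.symm x) - lam x = 0
      linarith⟩

/-- `p : Mh → M` is the minimal covering determined by the Lee form `θ`: `Mh` is the quotient
manifold `Mt / Γ₀` of the universal covering `π : Mt → M` by the kernel `Γ₀` of the homomorphism
`π₁(M) → ℝ`, `γ ↦ lam ∘ γ - lam`, where `lam` is a primitive of `π^* θ`, and `p` is the map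
induced by `π`. -/
def IsMinimalCovering {M : Type u} [TopologicalSpace M] [ChartedSpace E M] (θ : OneForm E M)
    {Mh : Type*} [TopologicalSpace Mh] [ChartedSpace E Mh] (p : Mh → M) : Prop :=
  IsSmoothCovering (E := E) p ∧
  ∃ (Mt : Type u) (_ : TopologicalSpace Mt) (_ : ChartedSpace E Mt)
    (_ : IsManifold 𝓘(ℝ, E) ∞ Mt) (π : Mt → M) (lam : Mt → ℝ) (q : Mt → Mh),
    SimplyConnectedSpace Mt ∧ IsSmoothCovering (E := E) π ∧ IsPrimitive π θ lam ∧
    IsLocalDiffeomorph 𝓘(ℝ, E) 𝓘(ℝ, E) ∞ q ∧ Function.Surjective q ∧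
    (∀ a b : Mt, q a = q b ↔ ∃ γ ∈ homothetyKernel π lam, γ a = b) ∧
    ∀ a : Mt, p (q a) = π a

end Coverings

section Actions

variable {E : Type*} [NormedAddCommGroup E] [NormedSpace ℝ E]
  {EG : Type*} [NormedAddCommGroup EG] [NormedSpace ℝ EG]

/-- The fundamental vector field on `M` of an element `X` of the Lie algebra of `G`. -/
def fundamentalField {G : Type*} [TopologicalSpace G] [ChartedSpace EG G] [Group G]
    {M : Type*} [TopologicalSpace M] [ChartedSpace E M] [MulAction G M]
    (X : GroupLieAlgebra 𝓘(ℝ, EG) G) (x : M) : TangentSpace 𝓘(ℝ, E) x :=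
  mfderiv 𝓘(ℝ, EG) 𝓘(ℝ, E) (fun g : G => g • x) 1 X

/-- The action of `G` on `M` is special lcs: all fundamental fields are special lcs. -/
def IsSpecialAction (EG : Type*) [NormedAddCommGroup EG] [NormedSpace ℝ EG]
    (G : Type*) [TopologicalSpace G] [ChartedSpace EG G] [Group G]
    {M : Type u} [TopologicalSpace M] [ChartedSpace E M] [MulAction G M]
    (Ω : DForm E M 2) (θ : OneForm E M) : Prop :=
  ∀ X : GroupLieAlgebra 𝓘(ℝ, EG) G,
    IsSpecialField Ω θ (fundamentalField (E := E) (M := M) X)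

end Actions

end LCS

end

open scoped Topology Manifold ContDiff

/-! A point of the minimal covering is determined by its image in `M` and the value of `lam`
(`IsMinimalCovering.eq_of_primitive_eq`), since the deck transformations preserving the primitive
have been divided out. This dictates the lifted action: `g • x` must be the point `y` over `g • p x`
for which `(g^* Ω)` at `p x` equals `e^{lam y - lam x} Ω` (`IsConformalLift`). Such a `y` is unique:
the non-zero form `Ω` fixes the conformal factor, hence `lam y`, hence `y`.

Existence is where speciality enters. Invariance of `Ω₀` under the lift of a fundamental field
descends to `M`: for a local primitive `f` of `θ`, the function `g ↦ e^{-f(g z)} (g^* Ω)_z(v)` has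
zero differential at `g = 1`, and by right translation at every `g` for which `f` is a primitive
near `g z`. It is therefore constant on connected sets of `g` whose orbit stays in the domain of a
local section `s` of `p`, with `f = lam ∘ s`. Conformal lifts thus continue along `G`, and
connectedness gives them for all `g` (`exists_isConformalLift`). No flow is integrated.

Uniqueness yields the action laws. Near `(1, x)` the action is `s (g • p y)`, hence continuous; the
group law spreads continuity to `G × Mh`, and smoothness follows because `p` is a local
diffeomorphism. Invariance of `Ω₀` is the defining identity of a conformal lift. -/

namespace LCS

universe u

/-! ### Calculus: smooth lifts, locally constant functions, Lie derivatives of forms -/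

section Calculus

/-- A continuous lift of a smooth map through a local diffeomorphism is smooth. -/
theorem contMDiffAt_of_lift {E : Type*} [NormedAddCommGroup E] [NormedSpace ℝ E]
    {F : Type*} [NormedAddCommGroup F] [NormedSpace ℝ F] {H : Type*} [TopologicalSpace H]
    {I : ModelWithCorners ℝ F H}
    {A : Type*} [TopologicalSpace A] [ChartedSpace H A]
    {M : Type*} [TopologicalSpace M] [ChartedSpace E M]
    {N : Type*} [TopologicalSpace N] [ChartedSpace E N]
    {p : N → M} (hp : IsLocalDiffeomorph 𝓘(ℝ, E) 𝓘(ℝ, E) ∞ p) {f : A → N} {a : A}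
    (hf : ContinuousAt f a) (hpf : ContMDiffAt I 𝓘(ℝ, E) ∞ (fun b => p (f b)) a) :
    ContMDiffAt I 𝓘(ℝ, E) ∞ f a := by
  have h := hp (f a)
  have h₁ : ContMDiffAt I 𝓘(ℝ, E) ∞ (fun b => h.localInverse (p (f b))) a :=
    (h.localInverse_contMDiffAt).comp a hpf
  refine h₁.congr_of_eventuallyEq ?_
  filter_upwards [hf.eventually h.localInverse_eventuallyEq_left] with b hb
  exact hb.symm

/-- A function with vanishing differential on a preconnected open set is constant there. -/
theorem eq_of_hasMFDerivAt_zero {F : Type*} [NormedAddCommGroup F] [NormedSpace ℝ F]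
    {A : Type*} [TopologicalSpace A] [ChartedSpace F A] [IsManifold 𝓘(ℝ, F) ∞ A]
    {f : A → ℝ} {W : Set A} (hWo : IsOpen W) (hW : IsPreconnected W)
    (hf : ∀ a ∈ W, HasMFDerivAt 𝓘(ℝ, F) 𝓘(ℝ) f a 0) {a b : A} (ha : a ∈ W) (hb : b ∈ W) :
    f a = f b := by
  have key : ∀ a ∈ W, ∀ᶠ b in 𝓝 a, f b = f a := by
    intro a ha
    set φ := chartAt F a
    have hopen : IsOpen (φ.target ∩ φ.symm ⁻¹' W) :=
      φ.isOpen_inter_preimage_symm hWo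
    have hmem : φ a ∈ φ.target ∩ φ.symm ⁻¹' W :=
      ⟨φ.map_source (mem_chart_source F a), by
        simpa [φ.left_inv (mem_chart_source F a)] using ha⟩
    obtain ⟨r, hr, hball⟩ := Metric.isOpen_iff.1 hopen _ hmem
    have hd : ∀ y ∈ Metric.ball (φ a) r, HasFDerivAt (f ∘ φ.symm) (0 : F →L[ℝ] ℝ) y := by
      intro y hy
      have h1 := hf _ (hball hy).2
      have h2 : MDifferentiableAt 𝓘(ℝ, F) 𝓘(ℝ, F) φ.symm y :=
        ((contMDiffOn_chart_symm (I := 𝓘(ℝ, F)) (n := ∞) (x := a)).contMDiffAt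
          (φ.open_target.mem_nhds (hball hy).1)).mdifferentiableAt (by simp)
      have h3 := h1.comp y h2.hasMFDerivAt
      rw [ContinuousLinearMap.zero_comp] at h3
      exact h3.hasFDerivAt
    have hconst : ∀ y ∈ Metric.ball (φ a) r, (f ∘ φ.symm) y = (f ∘ φ.symm) (φ a) := by
      intro y hy
      exact Metric.isOpen_ball.is_const_of_fderiv_eq_zero (convex_ball _ _).isPreconnected
        (fun z hz => (hd z hz).differentiableAt.differentiableWithinAt)
        (fun z hz => (hd z hz).fderiv) hy (Metric.mem_ball_self hr)
    have hc : ContinuousAt φ a := φ.continuousAt (mem_chart_source F a)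
    filter_upwards [hc.preimage_mem_nhds (Metric.ball_mem_nhds _ hr),
      φ.open_source.mem_nhds (mem_chart_source F a)] with b hb hb'
    have := hconst _ hb
    simpa [φ.left_inv hb', φ.left_inv (mem_chart_source F a)] using this
  refine hW.induction₂ (fun a b => f a = f b) (fun a ha => ?_)
    (fun _ _ _ _ _ _ h₁ h₂ => h₁.trans h₂) (fun _ _ _ _ h => h.symm) ha hb
  filter_upwards [nhdsWithin_le_nhds (key a ha)] with b hb using hb.symm

/-- The derivative of a pulled back form along a family of maps starting at the identity. -/
theorem hasFDerivAt_pullback_family {E F : Type*} [NormedAddCommGroup E] [NormedSpace ℝ E]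
    [NormedAddCommGroup F] [NormedSpace ℝ F] {k : ℕ}
    {A : F × E → E} {t₀ : F} {y₀ : E} (hA : ContDiffAt ℝ 2 A (t₀, y₀))
    (hid : ∀ᶠ y in 𝓝 y₀, A (t₀, y) = y)
    {η : E → E [⋀^Fin k]→L[ℝ] ℝ} (hη : DifferentiableAt ℝ η y₀) (u : Fin k → E) :
    DifferentiableAt ℝ
      (fun t => η (A (t, y₀)) (fun i => fderiv ℝ (fun y => A (t, y)) y₀ (u i))) t₀ ∧
    ∀ (τ : F) (V : E → E), (∀ᶠ y in 𝓝 y₀, V y = fderiv ℝ (fun t => A (t, y)) t₀ τ) →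
      fderiv ℝ (fun t => η (A (t, y₀)) (fun i => fderiv ℝ (fun y => A (t, y)) y₀ (u i))) t₀ τ
        = lieDerivE V η y₀ u := by
  have hd : ∀ᶠ q in 𝓝 (t₀, y₀), DifferentiableAt ℝ A q :=
    (hA.eventually (by simp)).mono fun q hq => hq.differentiableAt (by simp)
  have hA₀ : A (t₀, y₀) = y₀ := hid.self_of_nhds
  have hdA : DifferentiableAt ℝ A (t₀, y₀) := hd.self_of_nhds
  have hdd : DifferentiableAt ℝ (fderiv ℝ A) (t₀, y₀) :=
    (hA.fderiv_right (m := 1) (by norm_num [one_add_one_eq_two])).differentiableAt (by simp)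
  have hsymm : IsSymmSndFDerivAt ℝ A (t₀, y₀) := hA.isSymmSndFDerivAt (by simp)
  have hleft : HasFDerivAt (fun t : F => (t, y₀)) (ContinuousLinearMap.inl ℝ F E) t₀ :=
    hasFDerivAt_prodMk_left t₀ y₀
  have hright : HasFDerivAt (fun y : E => (t₀, y)) (ContinuousLinearMap.inr ℝ F E) y₀ :=
    hasFDerivAt_prodMk_right t₀ y₀
  have hB : ∀ᶠ t in 𝓝 t₀, fderiv ℝ (fun y => A (t, y)) y₀
      = (fderiv ℝ A (t, y₀)).comp (ContinuousLinearMap.inr ℝ F E) := by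
    filter_upwards [hleft.continuousAt.eventually hd] with t ht
    exact (ht.hasFDerivAt.comp y₀ (hasFDerivAt_prodMk_right t y₀)).fderiv
  have hV : ∀ᶠ y in 𝓝 y₀, fderiv ℝ (fun t => A (t, y)) t₀
      = (fderiv ℝ A (t₀, y)).comp (ContinuousLinearMap.inl ℝ F E) := by
    filter_upwards [hright.continuousAt.eventually hd] with y hy
    exact (hy.hasFDerivAt.comp t₀ (hasFDerivAt_prodMk_left t₀ y)).fderiv
  have hη' : HasFDerivAt η (fderiv ℝ η y₀) (A (t₀, y₀)) := by
    rw [hA₀]; exact hη.hasFDerivAt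
  have h1 : HasFDerivAt (fun t => η (A (t, y₀))) _ t₀ :=
    hη'.comp t₀ (hdA.hasFDerivAt.comp t₀ hleft)
  have h2 : ∀ i, HasFDerivAt (fun t => fderiv ℝ A (t, y₀) (0, u i)) _ t₀ := fun i =>
    (hdd.hasFDerivAt.comp t₀ hleft).clm_apply (hasFDerivAt_const ((0 : F), u i) t₀)
  have h3 := h1.continuousAlternatingMap_apply h2
  have h4 := h3.congr_of_eventuallyEq
    (f₁ := fun t => η (A (t, y₀)) (fun i => fderiv ℝ (fun y => A (t, y)) y₀ (u i))) (by
      filter_upwards [hB] with t ht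
      simp [ht])
  refine ⟨h4.differentiableAt, fun τ V hVτ => ?_⟩
  -- Since `A (t₀, ·)` is the identity near `y₀`, the vectors `u i` are unchanged at `t = t₀`.
  have hbase : ∀ w, fderiv ℝ A (t₀, y₀) (0, w) = w := by
    intro w
    have e1 := (hdA.hasFDerivAt.comp y₀ hright).congr_of_eventuallyEq (f₁ := id) (by
      filter_upwards [hid] with y hy
      exact hy.symm)
    have e2 := e1.unique (hasFDerivAt_id y₀)
    simpa using congrArg (fun l : E →L[ℝ] E => l w) e2
  have hVy : V y₀ = fderiv ℝ A (t₀, y₀) (τ, 0) := by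
    rw [hVτ.self_of_nhds, hV.self_of_nhds]; simp
  have hVd : HasFDerivAt V _ y₀ :=
    ((hdd.hasFDerivAt.comp y₀ hright).clm_apply
      (hasFDerivAt_const ((τ, 0) : F × E) y₀)).congr_of_eventuallyEq (by
      filter_upwards [hV, hVτ] with y hy hy'
      simp [hy', hy])
  rw [h4.fderiv, lieDerivE, hVd.fderiv]
  simp only [hA₀, hVy, add_apply, sum_apply,
    ContinuousLinearMap.comp_apply, hbase]
  congr 1
  -- The product rule yields `D²A (τ, 0) (0, u i)`, while the Lie derivative contains `D_{u i} V =
  -- D²A (0, u i) (τ, 0)`; they agree by symmetry of the second derivative.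
  refine Finset.sum_congr rfl fun i _ => ?_
  simp [hsymm.eq (τ, 0) (0, u i)]

end Calculus

/-! ### Pointwise rules for pullbacks -/

section Pullback

variable {E : Type*} [NormedAddCommGroup E] [NormedSpace ℝ E]
  {M : Type*} [TopologicalSpace M] [ChartedSpace E M]
  {N : Type*} [TopologicalSpace N] [ChartedSpace E N]
  {P : Type*} [TopologicalSpace P] [ChartedSpace E P]

theorem pullback_comp_apply {k : ℕ} (Ω : DForm E M k) {f : N → M} {h : P → N} {z : P}
    (hf : MDifferentiableAt 𝓘(ℝ, E) 𝓘(ℝ, E) f (h z))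
    (hh : MDifferentiableAt 𝓘(ℝ, E) 𝓘(ℝ, E) h z) :
    pullback (f ∘ h) Ω z = pullback h (pullback f Ω) z := by
  ext v
  simp only [pullback, mfderiv_comp z hf hh]
  rfl

theorem pullback_congr_apply {k : ℕ} (Ω : DForm E M k) {f h : N → M} {z : N}
    (hfh : f =ᶠ[𝓝 z] h) : pullback f Ω z = pullback h Ω z := by
  have key : ∀ (a b : M) (D : E →L[ℝ] E), a = b →
      ((Ω a : E [⋀^Fin k]→L[ℝ] ℝ).compContinuousLinearMap D) =
      ((Ω b : E [⋀^Fin k]→L[ℝ] ℝ).compContinuousLinearMap D) := by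
    rintro a _ D rfl; rfl
  have h1 : (mfderiv 𝓘(ℝ, E) 𝓘(ℝ, E) f z : E →L[ℝ] E) = mfderiv 𝓘(ℝ, E) 𝓘(ℝ, E) h z :=
    hfh.mfderiv_eq
  refine (key (f z) (h z) (mfderiv 𝓘(ℝ, E) 𝓘(ℝ, E) f z) hfh.self_of_nhds).trans ?_
  rw [h1]
  rfl

theorem pullback_smul_apply {k : ℕ} (c : M → ℝ) (Ω : DForm E M k) (f : N → M) (z : N) :
    pullback f (fun x => c x • Ω x) z = c (f z) • pullback f Ω z := by
  ext v
  rfl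

end Pullback

/-! ### From an invariant form upstairs to a stationary function on the group -/

section Infinitesimal

variable {E : Type*} [NormedAddCommGroup E] [NormedSpace ℝ E]
  {EG : Type*} [NormedAddCommGroup EG] [NormedSpace ℝ EG]
  {G : Type*} [TopologicalSpace G] [ChartedSpace EG G] [Group G] [LieGroup 𝓘(ℝ, EG) ∞ G]
  {M : Type*} [TopologicalSpace M] [ChartedSpace E M]
  [MulAction G M] [ContMDiffSMul 𝓘(ℝ, EG) 𝓘(ℝ, E) ∞ G M]

/-- If `e^{-μ} ψ^* Ω` is invariant under the lift `V` of a fundamental field along a local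
diffeomorphism `ψ`, then `e^{-f} g^* Ω` is stationary at `g = 1` in the direction of the field,
where `f` is a function on the base whose lift agrees with `μ` to first order. -/
theorem mfderiv_conf_pullback_smul_eq_zero_of_lieDerivE
    {Ω : DForm E M 2} {ψ : E → M} {y₁ : E} (hψ : IsLocalDiffeomorphAt 𝓘(ℝ, E) 𝓘(ℝ, E) ∞ ψ y₁)
    {μ : E → ℝ} (hμ : DifferentiableAt ℝ μ y₁) {η : E → E [⋀^Fin 2]→L[ℝ] ℝ}
    (hη : DifferentiableAt ℝ η y₁)
    (hηΩ : ∀ᶠ y in 𝓝 y₁, pullback ψ Ω y = Real.exp (μ y) • η y)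
    {X : GroupLieAlgebra 𝓘(ℝ, EG) G} {V : E → E}
    (hV : ∀ᶠ y in 𝓝 y₁, mfderiv 𝓘(ℝ, E) 𝓘(ℝ, E) ψ y (V y) = fundamentalField X (ψ y))
    (hLie : ∀ u, lieDerivE V η y₁ u = 0)
    {f : M → ℝ} (hf : MDifferentiableAt 𝓘(ℝ, E) 𝓘(ℝ) f (ψ y₁))
    (hfμ : mfderiv 𝓘(ℝ, E) 𝓘(ℝ) μ y₁ =
      (mfderiv 𝓘(ℝ, E) 𝓘(ℝ) f (ψ y₁)).comp (mfderiv 𝓘(ℝ, E) 𝓘(ℝ, E) ψ y₁)) :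
    ∀ v : Fin 2 → TangentSpace 𝓘(ℝ, E) (ψ y₁),
    MDifferentiableAt 𝓘(ℝ, EG) 𝓘(ℝ) (fun g : G => Real.exp (-f (g • ψ y₁)) *
      pullback (fun x : M => g • x) Ω (ψ y₁) v) 1 ∧
    mfderiv 𝓘(ℝ, EG) 𝓘(ℝ) (fun g : G => Real.exp (-f (g • ψ y₁)) *
      pullback (fun x : M => g • x) Ω (ψ y₁) v) 1 X = 0 := by
  set z := ψ y₁
  intro v
  have : ContinuousSMul G M := ContMDiffSMul.continuousSMul (I := 𝓘(ℝ, EG)) (I' := 𝓘(ℝ, E)) ∞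
  set χ := chartAt EG (1 : G)
  set σ := hψ.localInverse
  have hχ1 : (1 : G) ∈ χ.source := mem_chart_source EG 1
  have hzs : z ∈ σ.source := hψ.localInverse_mem_source
  have hσz : σ z = y₁ := hψ.localInverse_left_inv hψ.localInverse_mem_target
  have hσs : ∀ x ∈ σ.source, ContMDiffAt 𝓘(ℝ, E) 𝓘(ℝ, E) ∞ σ x := fun x hx =>
    hψ.localInverse_contMDiffOn.contMDiffAt (σ.open_source.mem_nhds hx)
  have hψσ : ∀ x ∈ σ.source, ψ (σ x) = x := fun x hx => hψ.localInverse_right_inv hx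
  have hψe : ∀ᶠ y in 𝓝 y₁, ContMDiffAt 𝓘(ℝ, E) 𝓘(ℝ, E) ∞ ψ y := by
    obtain ⟨Φ, h1, h2⟩ := hψ
    filter_upwards [Φ.open_source.mem_nhds h1] with y hy
    exact (Φ.isLocalDiffeomorphAt _ _ _ hy).contMDiffAt.congr_of_eventuallyEq
      (h2.eventuallyEq_of_mem (Φ.open_source.mem_nhds hy))
  -- the action in coordinates: a chart of `G` and the inverse of `ψ`
  set A : EG × E → E := fun q => σ (χ.symm q.1 • ψ q.2) with hA
  have hχs : ContMDiffAt 𝓘(ℝ, EG) 𝓘(ℝ, EG) ∞ χ.symm (χ 1) :=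
    (contMDiffOn_chart_symm (I := 𝓘(ℝ, EG)) (n := ∞) (x := (1 : G))).contMDiffAt
      (χ.open_target.mem_nhds (χ.map_source hχ1))
  have hχd : ContMDiffAt 𝓘(ℝ, EG) 𝓘(ℝ, EG) ∞ χ 1 :=
    (contMDiffOn_chart (I := 𝓘(ℝ, EG)) (n := ∞) (x := (1 : G))).contMDiffAt
      (χ.open_source.mem_nhds hχ1)
  have hχχ : χ.symm (χ 1) = 1 := χ.left_inv hχ1
  have hAd : ContDiffAt ℝ 2 A (χ 1, y₁) := by
    rw [← contMDiffAt_iff_contDiffAt]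
    have h1 : ContMDiffAt 𝓘(ℝ, EG × E) 𝓘(ℝ, EG) ∞ (fun q : EG × E => χ.symm q.1) (χ 1, y₁) :=
      ContMDiffAt.comp (χ 1, y₁) (g := χ.symm) hχs contDiffAt_fst.contMDiffAt
    have h2 : ContMDiffAt 𝓘(ℝ, EG × E) 𝓘(ℝ, E) ∞ (fun q : EG × E => ψ q.2) (χ 1, y₁) :=
      ContMDiffAt.comp (χ 1, y₁) (g := ψ) hψe.self_of_nhds contDiffAt_snd.contMDiffAt
    have h3 := h1.smul h2
    have h4 : ContMDiffAt 𝓘(ℝ, EG × E) 𝓘(ℝ, E) ∞ A (χ 1, y₁) := by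
      refine ContMDiffAt.comp (χ 1, y₁) (g := σ) ?_ h3
      apply hσs
      simpa [hχχ] using hzs
    exact h4.of_le (by norm_cast)
  have hid : ∀ᶠ y in 𝓝 y₁, A (χ 1, y) = y := by
    filter_upwards [hψ.localInverse_eventuallyEq_left] with y hy
    simpa [hA, hχχ] using hy
  have hAy : ∀ y, A (χ 1, y) = σ (ψ y) := fun y => by simp [hA, hχχ]
  have hsmul : ∀ x : M, ContMDiff 𝓘(ℝ, EG) 𝓘(ℝ, E) ∞ (fun g : G => g • x) := fun x =>
    contMDiff_id.smul (I' := 𝓘(ℝ, E)) contMDiff_const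
  have hsource : ∀ x ∈ σ.source, ∀ᶠ g in 𝓝 (1 : G), g • x ∈ σ.source := fun x hx =>
    (hsmul x).continuous.continuousAt.preimage_mem_nhds
      (σ.open_source.mem_nhds (by simpa using hx))
  set u : Fin 2 → E := fun i => mfderiv 𝓘(ℝ, E) 𝓘(ℝ, E) σ z (v i)
  obtain ⟨hΨd, hΨ⟩ := hasFDerivAt_pullback_family hAd hid hη u
  set Ψ : EG → ℝ := fun t => η (A (t, y₁)) (fun i => fderiv ℝ (fun y => A (t, y)) y₁ (u i))
  have hcσ : Filter.Tendsto (fun g : G => σ (g • z)) (𝓝 1) (𝓝 y₁) := by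
    have h1 : ContinuousAt σ ((1 : G) • z) := by
      rw [one_smul]; exact (hσs z hzs).continuousAt
    have h2 := ContinuousAt.comp (f := fun g : G => g • z) h1 (hsmul z).continuous.continuousAt
    have h3 : Filter.Tendsto (fun g : G => σ (g • z)) (𝓝 1) (𝓝 (σ ((1 : G) • z))) := h2
    rwa [one_smul, hσz] at h3
  -- Near `z` the action of `g` is `ψ ∘ A (χ g, ·) ∘ σ`. The pullback by `ψ` contributes the factor
  -- `e^μ` at the moved point, and what remains is the pullback of `η` by the family `A`.
  have hEq : ∀ᶠ g in 𝓝 (1 : G), pullback (fun x : M => g • x) Ω z v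
      = Real.exp (μ (σ (g • z))) * Ψ (χ g) := by
    filter_upwards [χ.open_source.mem_nhds hχ1, hsource z hzs, hcσ.eventually hηΩ,
      hcσ.eventually hψe] with g hg hgz hgη hgψ
    have hχg : χ.symm (χ g) = g := χ.left_inv hg
    have hAg : ∀ y, A (χ g, y) = σ (g • ψ y) := fun y => by simp [hA, hχg]
    have hcg : ContMDiff 𝓘(ℝ, E) 𝓘(ℝ, E) ∞ (fun x : M => g • x) :=
      ContMDiffSMul.contMDiff_const_smul (I := 𝓘(ℝ, EG)) g
    have e1 : (fun x : M => g • x) =ᶠ[𝓝 z] ψ ∘ ((fun y => A (χ g, y)) ∘ σ) := by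
      filter_upwards [σ.open_source.mem_nhds hzs,
        hcg.continuous.continuousAt.preimage_mem_nhds (σ.open_source.mem_nhds hgz)] with x hx hx'
      simp only [Function.comp_apply, hAg]
      rw [hψσ x hx, hψσ _ hx']
    have dσ : MDifferentiableAt 𝓘(ℝ, E) 𝓘(ℝ, E) σ z := (hσs z hzs).mdifferentiableAt (by simp)
    have dA : MDifferentiableAt 𝓘(ℝ, E) 𝓘(ℝ, E) (fun y => A (χ g, y)) (σ z) := by
      rw [hσz]
      have : ContMDiffAt 𝓘(ℝ, E) 𝓘(ℝ, E) ∞ (fun y => σ (g • ψ y)) y₁ :=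
        ContMDiffAt.comp y₁ (g := σ) (f := fun y => g • ψ y) (hσs _ hgz)
          (ContMDiffAt.comp y₁ (g := fun x : M => g • x) hcg.contMDiffAt hψe.self_of_nhds)
      simp only [hAg]
      exact this.mdifferentiableAt (by simp)
    have hpt : A (χ g, σ z) = σ (g • z) := by rw [hAg, hψσ z hzs]
    have dψ : MDifferentiableAt 𝓘(ℝ, E) 𝓘(ℝ, E) ψ (((fun y => A (χ g, y)) ∘ σ) z) := by
      simp only [Function.comp_apply, hpt]
      exact hgψ.mdifferentiableAt (by simp)
    rw [pullback_congr_apply Ω e1, pullback_comp_apply Ω dψ (dA.comp z dσ)]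
    have e2 : pullback ((fun y => A (χ g, y)) ∘ σ) (pullback ψ Ω) z v
        = (pullback ψ Ω (A (χ g, σ z)) : E [⋀^Fin 2]→L[ℝ] ℝ)
          (fun i => fderiv ℝ (fun y => A (χ g, y)) (σ z) (u i)) := by
      simp only [pullback, mfderiv_comp z dA dσ, mfderiv_eq_fderiv]
      rfl
    rw [e2, hpt, hgη, hσz]
    have hpt' : A (χ g, y₁) = σ (g • z) := by rw [← hσz, hpt]
    simp only [Ψ, hpt']
    rfl
  have hVA : ∀ᶠ y in 𝓝 y₁, V y = fderiv ℝ (fun t => A (t, y)) (χ 1)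
      (mfderiv 𝓘(ℝ, EG) 𝓘(ℝ, EG) χ 1 X) := by
    have hsrc : ∀ᶠ y in 𝓝 y₁, ψ y ∈ σ.source :=
      hψe.self_of_nhds.continuousAt.preimage_mem_nhds (σ.open_source.mem_nhds hzs)
    filter_upwards [hV, hψe, hψ.localInverse_eventuallyEq_left.eventually_nhds, hsrc]
      with y hVy hψy hinv hy
    have hy1 : A (χ 1, y) = y := (hAy y).trans hinv.self_of_nhds
    have dψ : MDifferentiableAt 𝓘(ℝ, E) 𝓘(ℝ, E) ψ y := hψy.mdifferentiableAt (by simp)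
    -- Quantifying over `a = y` moves the base point without transporting between tangent spaces.
    have dψ' : ∀ a, a = y → HasMFDerivAt 𝓘(ℝ, E) 𝓘(ℝ, E) ψ a
        (mfderiv 𝓘(ℝ, E) 𝓘(ℝ, E) ψ y : E →L[ℝ] E) := by
      rintro _ rfl; exact dψ.hasMFDerivAt
    have dσ : MDifferentiableAt 𝓘(ℝ, E) 𝓘(ℝ, E) σ (ψ y) := (hσs _ hy).mdifferentiableAt (by simp)
    have hinj : ∀ w : E, mfderiv 𝓘(ℝ, E) 𝓘(ℝ, E) σ (ψ y)
        (mfderiv 𝓘(ℝ, E) 𝓘(ℝ, E) ψ y w) = w := by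
      intro w
      have h1 := (dσ.hasMFDerivAt.comp y dψ.hasMFDerivAt).congr_of_eventuallyEq
        (f₁ := id) (Filter.EventuallyEq.symm hinv)
      have h2 := hasMFDerivAt_unique h1 (hasMFDerivAt_id y)
      exact congrArg (fun l : E →L[ℝ] E => l w) h2
    have dAt : MDifferentiableAt 𝓘(ℝ, EG) 𝓘(ℝ, E) (fun t => A (t, y)) (χ 1) := by
      have h1 : ContMDiffAt 𝓘(ℝ, EG) 𝓘(ℝ, E) ∞ (fun t => χ.symm t • ψ y) (χ 1) :=
        ContMDiffAt.comp (χ 1) (g := fun g : G => g • ψ y) (hsmul _).contMDiffAt hχs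
      have h2 : ContMDiffAt 𝓘(ℝ, EG) 𝓘(ℝ, E) ∞ (fun t => σ (χ.symm t • ψ y)) (χ 1) :=
        ContMDiffAt.comp (χ 1) (g := σ) (hσs _ (by simpa [hχχ] using hy)) h1
      exact h2.mdifferentiableAt (by simp)
    have dχ : MDifferentiableAt 𝓘(ℝ, EG) 𝓘(ℝ, EG) χ 1 := hχd.mdifferentiableAt (by simp)
    have h1 := (dψ' _ hy1).comp 1 (f := (fun t => A (t, y)) ∘ χ)
      (dAt.hasMFDerivAt.comp 1 dχ.hasMFDerivAt)
    have h2 := h1.congr_of_eventuallyEq (f₁ := fun g : G => g • ψ y) (by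
      filter_upwards [χ.open_source.mem_nhds hχ1, hsource _ hy] with g hg hgy
      simp only [Function.comp_apply, hA, χ.left_inv hg]
      exact (hψσ _ hgy).symm)
    have h3 : (fundamentalField X (ψ y) : E) = mfderiv 𝓘(ℝ, E) 𝓘(ℝ, E) ψ y
        (fderiv ℝ (fun t => A (t, y)) (χ 1) (mfderiv 𝓘(ℝ, EG) 𝓘(ℝ, EG) χ 1 X)) := by
      rw [← mfderiv_eq_fderiv]
      exact congrArg (fun l : EG →L[ℝ] E => l X) h2.mfderiv
    rw [← hinj (V y), hVy]
    exact (congrArg (mfderiv 𝓘(ℝ, E) 𝓘(ℝ, E) σ (ψ y)) h3).trans (hinj _)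
  -- The differentials of `μ ∘ σ` and `f` agree at `z`, so replacing one by the other in the
  -- exponent does not change first derivatives.
  have hq : HasMFDerivAt 𝓘(ℝ, E) 𝓘(ℝ) (fun x => μ (σ x) - f x) z 0 := by
    have dμ : ∀ a, a = y₁ → HasMFDerivAt 𝓘(ℝ, E) 𝓘(ℝ) μ a
        (mfderiv 𝓘(ℝ, E) 𝓘(ℝ) μ y₁ : E →L[ℝ] ℝ) := by
      rintro _ rfl; exact hμ.mdifferentiableAt.hasMFDerivAt
    have dψ : ∀ a, a = y₁ → HasMFDerivAt 𝓘(ℝ, E) 𝓘(ℝ, E) ψ a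
        (mfderiv 𝓘(ℝ, E) 𝓘(ℝ, E) ψ y₁ : E →L[ℝ] E) := by
      rintro _ rfl; exact (hψe.self_of_nhds.mdifferentiableAt (by simp)).hasMFDerivAt
    have dσ : MDifferentiableAt 𝓘(ℝ, E) 𝓘(ℝ, E) σ z := (hσs z hzs).mdifferentiableAt (by simp)
    have h1 := ((dψ _ hσz).comp z dσ.hasMFDerivAt).congr_of_eventuallyEq (f₁ := id)
      (Filter.EventuallyEq.symm hψ.localInverse_eventuallyEq_right)
    have h2 : ∀ w : E, mfderiv 𝓘(ℝ, E) 𝓘(ℝ, E) ψ y₁ (mfderiv 𝓘(ℝ, E) 𝓘(ℝ, E) σ z w) = w :=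
      fun w => congrArg (fun l : E →L[ℝ] E => l w) (hasMFDerivAt_unique h1 (hasMFDerivAt_id z))
    have h3 := ((dμ _ hσz).comp z dσ.hasMFDerivAt).sub hf.hasMFDerivAt
    refine HasMFDerivAt.congr_mfderiv h3 (ContinuousLinearMap.ext fun w => Eq.symm ?_)
    let Dμ : E →L[ℝ] ℝ := mfderiv 𝓘(ℝ, E) 𝓘(ℝ) μ y₁
    let Df : E →L[ℝ] ℝ := mfderiv 𝓘(ℝ, E) 𝓘(ℝ) f z
    let Dσ : E →L[ℝ] E := mfderiv 𝓘(ℝ, E) 𝓘(ℝ, E) σ z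
    have h4 : Dμ (Dσ w) = Df w :=
      (congrArg (fun l : E →L[ℝ] ℝ => l (Dσ w)) hfμ).trans (congrArg Df (h2 w))
    exact (sub_eq_zero.2 h4).symm
  have hk : HasMFDerivAt 𝓘(ℝ, EG) 𝓘(ℝ)
      (fun g : G => Real.exp (μ (σ (g • z)) - f (g • z))) 1 0 := by
    have h1 : HasMFDerivAt 𝓘(ℝ, E) 𝓘(ℝ) (fun x => μ (σ x) - f x) ((1 : G) • z) 0 := by
      rw [one_smul]; exact hq
    have h2 := h1.comp (1 : G) (f := fun g : G => g • z)
      ((hsmul z).mdifferentiableAt (by simp)).hasMFDerivAt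
    have h3 := (Real.hasDerivAt_exp (μ (σ ((1 : G) • z)) - f ((1 : G) • z))).hasFDerivAt.hasMFDerivAt
    have h4 := HasMFDerivAt.comp (1 : G) (g := Real.exp)
      (f := fun g : G => μ (σ (g • z)) - f (g • z)) h3 h2
    refine HasMFDerivAt.congr_mfderiv h4 ?_
    rw [ContinuousLinearMap.zero_comp]
    exact ContinuousLinearMap.comp_zero _
  have hΨχ : MDifferentiableAt 𝓘(ℝ, EG) 𝓘(ℝ) (fun g : G => Ψ (χ g)) 1 ∧
      mfderiv 𝓘(ℝ, EG) 𝓘(ℝ) (fun g : G => Ψ (χ g)) 1 X = 0 := by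
    have h1 := HasMFDerivAt.comp (1 : G) (g := Ψ) (f := χ) hΨd.hasFDerivAt.hasMFDerivAt
      (hχd.mdifferentiableAt (by simp)).hasMFDerivAt
    refine ⟨h1.mdifferentiableAt, ?_⟩
    have h2 := hΨ (mfderiv 𝓘(ℝ, EG) 𝓘(ℝ, EG) χ 1 X) V hVA
    rw [hLie] at h2
    exact (congrArg (fun l : EG →L[ℝ] ℝ => l X) h1.mfderiv).trans h2
  -- The function is `e^{μ(σ(g z)) - f(g z)}` times `Ψ (χ g)`: the first factor is stationary in
  -- every direction, the second in the direction `X`.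
  have hprod := hk.mul hΨχ.1.hasMFDerivAt
  have hfin := hprod.congr_of_eventuallyEq (f₁ := fun g : G => Real.exp (-f (g • z)) *
      pullback (fun x : M => g • x) Ω z v) (by
    filter_upwards [hEq] with g hg
    rw [hg, ← mul_assoc, ← Real.exp_add]
    simp only [Pi.mul_apply]
    congr 2
    ring)
  refine ⟨hfin.mdifferentiableAt, ?_⟩
  rw [hfin.mfderiv]
  let D : EG →L[ℝ] ℝ := mfderiv 𝓘(ℝ, EG) 𝓘(ℝ) (fun g : G => Ψ (χ g)) 1
  have hD : D X = 0 := hΨχ.2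
  change Real.exp (μ (σ ((1 : G) • z)) - f ((1 : G) • z)) * D X + Ψ (χ 1) * (0 : ℝ) = (0 : ℝ)
  rw [hD, mul_zero, mul_zero, add_zero]

end Infinitesimal

/-! ### Special actions: stationarity along orbits -/

section Special

theorem isLocalDiffeomorphAt_chart_symm {E : Type*} [NormedAddCommGroup E] [NormedSpace ℝ E]
    {M : Type*} [TopologicalSpace M] [ChartedSpace E M] [IsManifold 𝓘(ℝ, E) ∞ M] (x : M) {y : E}
    (hy : y ∈ (chartAt E x).target) :
    IsLocalDiffeomorphAt 𝓘(ℝ, E) 𝓘(ℝ, E) ∞ (chartAt E x).symm y := by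
  let Φ : PartialDiffeomorph 𝓘(ℝ, E) 𝓘(ℝ, E) E M ∞ :=
    { toPartialEquiv := (chartAt E x).symm.toPartialEquiv
      open_source := (chartAt E x).open_target
      open_target := (chartAt E x).open_source
      contMDiffOn_toFun := contMDiffOn_chart_symm
      contMDiffOn_invFun := contMDiffOn_chart }
  exact Φ.isLocalDiffeomorphAt _ _ _ hy

variable {E : Type*} [NormedAddCommGroup E] [NormedSpace ℝ E]
  {EG : Type*} [NormedAddCommGroup EG] [NormedSpace ℝ EG]
  {G : Type*} [TopologicalSpace G] [ChartedSpace EG G] [Group G] [LieGroup 𝓘(ℝ, EG) ∞ G]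
  {M : Type u} [TopologicalSpace M] [ChartedSpace E M]
  [MulAction G M] [ContMDiffSMul 𝓘(ℝ, EG) 𝓘(ℝ, E) ∞ G M]

/-- The presentation witnessing speciality may vary with `X`. The conclusion mentions only `Ω` and a
function on `M` with differential `θ z` at `z`, so the results for different `X` can be combined.
The proof takes `ψ` to be an inverse chart of `M₀` followed by `p`. -/
theorem mfderiv_conf_pullback_smul_eq_zero {Ω : DForm E M 2} {θ : OneForm E M}
    {X : GroupLieAlgebra 𝓘(ℝ, EG) G}
    (hX : IsSpecialField Ω θ (fundamentalField (E := E) (M := M) X))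
    {z : M} {f : M → ℝ} (hf : MDifferentiableAt 𝓘(ℝ, E) 𝓘(ℝ) f z)
    (hfθ : mfderiv 𝓘(ℝ, E) 𝓘(ℝ) f z = θ z) (v : Fin 2 → TangentSpace 𝓘(ℝ, E) z) :
    MDifferentiableAt 𝓘(ℝ, EG) 𝓘(ℝ) (fun g : G => Real.exp (-f (g • z)) *
      pullback (fun x : M => g • x) Ω z v) 1 ∧
    mfderiv 𝓘(ℝ, EG) 𝓘(ℝ) (fun g : G => Real.exp (-f (g • z)) *
      pullback (fun x : M => g • x) Ω z v) 1 X = 0 := by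
  obtain ⟨M₀, _, _, _, _, _, p, Ω₀, Γ, _, _, ρ, lam, hpres, hLie⟩ := hX
  obtain ⟨m, hm⟩ := hpres.surjective z
  have hy₁ : chartAt E m m ∈ (chartAt E m).target := mem_chart_target E m
  have hz : (p ∘ (chartAt E m).symm) (chartAt E m m) = z := by
    simp [(chartAt E m).left_inv (mem_chart_source E m), hm]
  generalize chartAt E m m = y₁ at hy₁ hz
  subst hz
  have hφ : ∀ y ∈ (chartAt E m).target,
      IsLocalDiffeomorphAt 𝓘(ℝ, E) 𝓘(ℝ, E) ∞ (chartAt E m).symm y := fun y hy =>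
    isLocalDiffeomorphAt_chart_symm m hy
  have hT : ∀ᶠ y in 𝓝 y₁, y ∈ (chartAt E m).target := (chartAt E m).open_target.mem_nhds hy₁
  have hchain : ∀ y ∈ (chartAt E m).target,
      mfderiv 𝓘(ℝ, E) 𝓘(ℝ, E) (p ∘ (chartAt E m).symm) y =
        (mfderiv 𝓘(ℝ, E) 𝓘(ℝ, E) p ((chartAt E m).symm y)).comp
          (mfderiv 𝓘(ℝ, E) 𝓘(ℝ, E) (chartAt E m).symm y) := fun y hy =>
    mfderiv_comp y ((hpres.local_diffeo _).mdifferentiableAt (by simp))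
      ((hφ y hy).mdifferentiableAt (by simp))
  have hlam : ContMDiffAt 𝓘(ℝ, E) 𝓘(ℝ) ∞ (lam ∘ (chartAt E m).symm) y₁ :=
    hpres.primitive.smooth.contMDiffAt.comp y₁ (hφ y₁ hy₁).contMDiffAt
  refine mfderiv_conf_pullback_smul_eq_zero_of_lieDerivE
    (ψ := p ∘ (chartAt E m).symm) (y₁ := y₁) (μ := lam ∘ (chartAt E m).symm)
    (η := formInChart Ω₀ m)
    (V := fieldInChart (VectorField.mpullback 𝓘(ℝ, E) 𝓘(ℝ, E) p (fundamentalField X)) m)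
    ((hφ y₁ hy₁).comp _ _ (hpres.local_diffeo _)) ?_ ?_ ?_ ?_ (hLie m y₁ hy₁) hf ?_ v
  · exact hlam.contDiffAt.differentiableAt (by simp)
  · exact ((hpres.symplectic.smooth m).contDiffAt
      ((chartAt E m).open_target.mem_nhds hy₁)).differentiableAt (by simp)
  · filter_upwards [hT] with y hy
    rw [pullback_comp_apply Ω ((hpres.local_diffeo _).mdifferentiableAt (by simp))
      ((hφ y hy).mdifferentiableAt (by simp)), hpres.form_eq, pullback_smul_apply]
    rfl
  · filter_upwards [hT] with y hy
    rw [hchain y hy]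
    have h1 := (hpres.local_diffeo ((chartAt E m).symm y)).mfderivToContinuousLinearEquiv_coe
      (by simp)
    have h2 := (hφ y hy).mfderivToContinuousLinearEquiv_coe (by simp)
    simp only [fieldInChart, VectorField.mpullback_apply, ContinuousLinearMap.comp_apply]
    rw [← h1, ← h2, ContinuousLinearMap.inverse_equiv, ContinuousLinearMap.inverse_equiv]
    generalize (hφ y hy).mfderivToContinuousLinearEquiv _ = L₁
    generalize (hpres.local_diffeo _).mfderivToContinuousLinearEquiv _ = L₂
    exact (congrArg L₂ (L₁.apply_symm_apply _)).trans (L₂.apply_symm_apply _)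
  · rw [hfθ, hchain y₁ hy₁, mfderiv_comp y₁ (hpres.primitive.smooth.mdifferentiableAt (by simp))
      ((hφ y₁ hy₁).mdifferentiableAt (by simp)), hpres.primitive.deriv_eq]
    rfl

theorem hasMFDerivAt_conf_pullback_smul_one {Ω : DForm E M 2} {θ : OneForm E M}
    (hG : IsSpecialAction EG G Ω θ)
    {z : M} {f : M → ℝ} (hf : MDifferentiableAt 𝓘(ℝ, E) 𝓘(ℝ) f z)
    (hfθ : mfderiv 𝓘(ℝ, E) 𝓘(ℝ) f z = θ z) (v : Fin 2 → TangentSpace 𝓘(ℝ, E) z) :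
    HasMFDerivAt 𝓘(ℝ, EG) 𝓘(ℝ) (fun g : G => Real.exp (-f (g • z)) *
      pullback (fun x : M => g • x) Ω z v) 1 0 := by
  -- Differentiability does not involve `X`, so the zero element supplies it.
  refine (mfderiv_conf_pullback_smul_eq_zero (hG 0) hf hfθ v).1.hasMFDerivAt.congr_mfderiv
    (ContinuousLinearMap.ext fun X => ?_)
  exact (mfderiv_conf_pullback_smul_eq_zero (hG X) hf hfθ v).2

/-- Along an orbit of a special action, `e^{-f} g^* Ω` is infinitesimally constant for a local
primitive `f` of the Lee form. -/
theorem hasMFDerivAt_conf_pullback_smul {Ω : DForm E M 2} {θ : OneForm E M}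
    (hG : IsSpecialAction EG G Ω θ) (g₀ : G)
    {z : M} {f : M → ℝ} (hf : MDifferentiableAt 𝓘(ℝ, E) 𝓘(ℝ) f (g₀ • z))
    (hfθ : mfderiv 𝓘(ℝ, E) 𝓘(ℝ) f (g₀ • z) = θ (g₀ • z))
    (v : Fin 2 → TangentSpace 𝓘(ℝ, E) z) :
    HasMFDerivAt 𝓘(ℝ, EG) 𝓘(ℝ) (fun g : G => Real.exp (-f (g • z)) *
      pullback (fun x : M => g • x) Ω z v) g₀ 0 := by
  have hd : ∀ (g : G) (x : M), MDifferentiableAt 𝓘(ℝ, E) 𝓘(ℝ, E) (fun x : M => g • x) x :=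
    fun g x => (ContMDiffSMul.contMDiff_const_smul (I := 𝓘(ℝ, EG)) (I' := 𝓘(ℝ, E)) (n := ∞)
      g).mdifferentiableAt (by simp)
  have h1 := hasMFDerivAt_conf_pullback_smul_one hG hf hfθ
    (fun i => mfderiv 𝓘(ℝ, E) 𝓘(ℝ, E) (fun x : M => g₀ • x) z (v i))
  have hr : MDifferentiableAt 𝓘(ℝ, EG) 𝓘(ℝ, EG) (fun g : G => g * g₀⁻¹) g₀ :=
    (contMDiff_mul_right (I := 𝓘(ℝ, EG)) (n := ∞) (a := g₀⁻¹)).mdifferentiableAt (by simp)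
  -- Right translation: `g = (g g₀⁻¹) g₀` reduces the claim at `g₀` and `z` to the one at `1` and
  -- `g₀ • z`, with the vectors pushed forward by `g₀`.
  rw [← mul_inv_cancel g₀] at h1
  have h2 := HasMFDerivAt.comp g₀ (f := fun g : G => g * g₀⁻¹) h1 hr.hasMFDerivAt
  rw [ContinuousLinearMap.zero_comp] at h2
  refine h2.congr_of_eventuallyEq (Filter.Eventually.of_forall fun g => ?_)
  have h3 : (fun x : M => g • x) = (fun x : M => (g * g₀⁻¹) • x) ∘ (fun x : M => g₀ • x) := by
    funext x
    simp [mul_smul]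
  have h4 : pullback (fun x : M => g • x) Ω z v = pullback (fun x : M => (g * g₀⁻¹) • x) Ω (g₀ • z)
      (fun i => mfderiv 𝓘(ℝ, E) 𝓘(ℝ, E) (fun x : M => g₀ • x) z (v i)) := by
    rw [h3, pullback_comp_apply Ω (hd _ _) (hd _ _)]
    rfl
  simp only [Function.comp_apply, h4]
  rw [← mul_smul, inv_mul_cancel_right]

end Special

/-! ### The minimal covering and local sections -/

section Covering

variable {E : Type*} [NormedAddCommGroup E] [NormedSpace ℝ E]
  {M : Type u} [TopologicalSpace M] [ChartedSpace E M]
  {N : Type*} [TopologicalSpace N] [ChartedSpace E N]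

theorem IsPrimitive.mfderiv_comp_eq {P : Type*} [TopologicalSpace P] [ChartedSpace E P]
    {p : N → M} {θ : OneForm E M} {lam : N → ℝ} (hlam : IsPrimitive p θ lam)
    {q : P → N} {π : P → M} (hπ : p ∘ q = π) (y : P)
    (hp : MDifferentiableAt 𝓘(ℝ, E) 𝓘(ℝ, E) p (q y))
    (hq : MDifferentiableAt 𝓘(ℝ, E) 𝓘(ℝ, E) q y) :
    mfderiv 𝓘(ℝ, E) 𝓘(ℝ) (lam ∘ q) y = (θ (π y)).comp (mfderiv 𝓘(ℝ, E) 𝓘(ℝ, E) π y) := by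
  subst hπ
  rw [mfderiv_comp y (hlam.smooth.mdifferentiableAt (by simp)) hq, mfderiv_comp y hp hq,
    hlam.deriv_eq]
  rfl

theorem sub_eq_sub_of_mfderiv_eq [IsManifold 𝓘(ℝ, E) ∞ N] [PreconnectedSpace N] {f h : N → ℝ}
    (hf : MDifferentiable 𝓘(ℝ, E) 𝓘(ℝ) f) (hh : MDifferentiable 𝓘(ℝ, E) 𝓘(ℝ) h)
    (hfh : ∀ y, (mfderiv 𝓘(ℝ, E) 𝓘(ℝ) f y : E →L[ℝ] ℝ) = mfderiv 𝓘(ℝ, E) 𝓘(ℝ) h y) (a b : N) :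
    f a - h a = f b - h b := by
  refine eq_of_hasMFDerivAt_zero (F := E) (f := fun y => f y - h y) isOpen_univ isPreconnected_univ
    (fun y _ => ?_) (Set.mem_univ a) (Set.mem_univ b)
  exact ((hf y).hasMFDerivAt.sub (hh y).hasMFDerivAt).congr_mfderiv (sub_eq_zero.2 (hfh y))

/-- The deck transformation of a simply connected covering which maps `a` to `b`. -/
theorem exists_deck_transformation {X Y : Type*} [TopologicalSpace X] [TopologicalSpace Y]
    [SimplyConnectedSpace Y] [LocallyPathConnectedSpace Y] {π : Y → X} (hπ : IsCoveringMap π)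
    {a b : Y} (hab : π a = π b) : ∃ γ : Y ≃ₜ Y, (∀ y, π (γ y) = π y) ∧ γ a = b := by
  obtain ⟨F, ⟨hFa, hF⟩, -⟩ :=
    hπ.existsUnique_continuousMap_lifts ⟨π, hπ.continuous⟩ a b hab.symm
  obtain ⟨F', ⟨hFb, hF'⟩, -⟩ :=
    hπ.existsUnique_continuousMap_lifts ⟨π, hπ.continuous⟩ b a hab
  have h1 : ∀ y, π (F y) = π y := congrFun hF
  have h2 : ∀ y, π (F' y) = π y := congrFun hF'
  have h3 : (F' ∘ F : Y → Y) = id :=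
    hπ.eq_of_comp_eq (F'.continuous.comp F.continuous) continuous_id
      (by funext y; simp [h1, h2]) a (by simp [hFa, hFb])
  have h4 : (F ∘ F' : Y → Y) = id :=
    hπ.eq_of_comp_eq (F.continuous.comp F'.continuous) continuous_id
      (by funext y; simp [h1, h2]) b (by simp [hFa, hFb])
  exact ⟨⟨⟨F, F', congrFun h3, congrFun h4⟩, F.continuous, F'.continuous⟩, h1, hFa⟩

/-- A point of the minimal covering is determined by its projection and by the value of a
primitive of the Lee form. -/
theorem IsMinimalCovering.eq_of_primitive_eq {θ : OneForm E M} {p : N → M}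
    (hp : IsMinimalCovering θ p) {lam : N → ℝ} (hlam : IsPrimitive p θ lam) {a b : N}
    (hab : p a = p b) (hlab : lam a = lam b) : a = b := by
  obtain ⟨hpc, Mt, _, _, _, π, lamt, q, _, hπ, hlamt, hq, hqs, hfib, hpq⟩ := hp
  have : LocallyPathConnectedSpace Mt := ChartedSpace.locallyPathConnectedSpace E Mt
  obtain ⟨a, rfl⟩ := hqs a
  obtain ⟨b, rfl⟩ := hqs b
  rw [hpq, hpq] at hab
  obtain ⟨γ, hγπ, hγ⟩ := exists_deck_transformation hπ.covering hab
  have hγd : MDifferentiable 𝓘(ℝ, E) 𝓘(ℝ, E) γ := fun y =>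
    (contMDiffAt_of_lift hπ.local_diffeo γ.continuous.continuousAt (by
      simp only [hγπ]
      exact hπ.local_diffeo.contMDiff y)).mdifferentiableAt (by simp)
  have hπd := hπ.local_diffeo.mdifferentiable (by simp)
  have hqd := hq.mdifferentiable (by simp)
  have hlamtd := hlamt.smooth.mdifferentiable (by simp)
  -- Both `lamt ∘ γ - lamt` and `lam ∘ q - lamt` are constant. Evaluating at `a` and `b = γ a`,
  -- equality of `lam` at the images makes the first constant zero, so `γ` lies in the kernel and `q
  -- a = q b`.
  have h1 := sub_eq_sub_of_mfderiv_eq (hlamtd.comp hγd) hlamtd fun y =>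
    (hlamt.mfderiv_comp_eq (funext hγπ) y (hπd _) (hγd y)).trans (hlamt.deriv_eq y).symm
  have h2 := sub_eq_sub_of_mfderiv_eq ((hlam.smooth.mdifferentiable (by simp)).comp hqd) hlamtd
    fun y => (hlam.mfderiv_comp_eq (funext hpq) y
      (hpc.local_diffeo.mdifferentiable (by simp) _) (hqd y)).trans (hlamt.deriv_eq y).symm
  refine (hfib a b).2 ⟨γ, ⟨hγπ, fun x => ?_⟩, hγ⟩
  have h3 := h1 x a
  have h4 := h2 a b
  simp only [Function.comp_apply, hγ] at h3 h4
  linarith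

/-- Locally, every point over a neighbourhood lies on a continuous section of a covering. -/
theorem exists_section_of_isCoveringMap {X Y : Type*} [TopologicalSpace X] [TopologicalSpace Y]
    {p : Y → X} (hp : IsCoveringMap p) (x : X) : ∃ U : Set X, IsOpen U ∧ x ∈ U ∧
      ∀ y, p y ∈ U → ∃ s : X → Y, ContinuousOn s U ∧ (∀ u ∈ U, p (s u) = u) ∧ s (p y) = y := by
  classical
  obtain ⟨-, U, hxU, hU, -, H, hH⟩ := hp x
  refine ⟨U, hU, hxU, fun y hy => ?_⟩
  -- The section keeps the fibre coordinate of `y` constant; its value off `U` is arbitrary. The set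
  -- `U` does not depend on `y`.
  refine ⟨fun u => if h : u ∈ U then (H.symm (⟨u, h⟩, (H ⟨y, hy⟩).2)).1 else y, ?_, ?_, ?_⟩
  · rw [continuousOn_iff_continuous_domRestrict]
    have : (U.domRestrict fun u => if h : u ∈ U then (H.symm (⟨u, h⟩, (H ⟨y, hy⟩).2)).1 else y)
        = fun u : U => (H.symm (u, (H ⟨y, hy⟩).2)).1 := by
      funext u
      simp [Set.domRestrict]
    rw [this]
    fun_prop
  · intro u hu
    simp only [hu, dif_pos]
    rw [← hH, H.apply_symm_apply]
  · have h1 : (⟨p y, hy⟩ : U) = (H ⟨y, hy⟩).1 := Subtype.ext (hH ⟨y, hy⟩).symm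
    simp only [hy, dif_pos]
    rw [h1, Prod.mk.eta, H.symm_apply_apply]

end Covering

/-! ### Conformal lifts: composition and uniqueness -/

section ConformalLift

variable {E : Type*} [NormedAddCommGroup E] [NormedSpace ℝ E] {G : Type*} [Group G]
  {M : Type*} [TopologicalSpace M] [ChartedSpace E M] [MulAction G M] {N : Type*}

/-- The point `y` lies over `g • p x`, and `lam y - lam x` is the logarithm of the conformal factor
of `g` at `p x`. -/
def IsConformalLift (Ω : DForm E M 2) (p : N → M) (lam : N → ℝ) (g : G) (x y : N) : Prop :=
  p y = g • p x ∧ ∀ v : Fin 2 → TangentSpace 𝓘(ℝ, E) (p x),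
    pullback (fun m : M => g • m) Ω (p x) v = Real.exp (lam y - lam x) * Ω (p x) v

variable {Ω : DForm E M 2} {p : N → M} {lam : N → ℝ}

theorem IsConformalLift.one (x : N) : IsConformalLift Ω p lam (1 : G) x x := by
  refine ⟨(one_smul G _).symm, fun v => ?_⟩
  have h : (fun m : M => (1 : G) • m) =ᶠ[𝓝 (p x)] id :=
    Filter.Eventually.of_forall fun m => one_smul G m
  rw [pullback_congr_apply Ω h, sub_self, Real.exp_zero, one_mul]
  simp only [pullback, mfderiv_id]
  rfl

theorem IsConformalLift.mul
    (hd : ∀ (g : G) (m : M), MDifferentiableAt 𝓘(ℝ, E) 𝓘(ℝ, E) (fun m : M => g • m) m)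
    {g h : G} {x y w : N} (hg : IsConformalLift Ω p lam g x y)
    (hh : IsConformalLift Ω p lam h y w) : IsConformalLift Ω p lam (h * g) x w := by
  refine ⟨by rw [hh.1, hg.1, mul_smul], fun v => ?_⟩
  have h1 : ∀ m, p y = m → ∀ v : Fin 2 → TangentSpace 𝓘(ℝ, E) m,
      pullback (fun m : M => h • m) Ω m v = Real.exp (lam w - lam y) * Ω m v := by
    rintro _ rfl; exact hh.2
  have h2 : (fun m : M => (h * g) • m) = (fun m : M => h • m) ∘ (fun m : M => g • m) := by
    funext m
    simp [mul_smul]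
  have h3 : pullback (fun m : M => g • m) (pullback (fun m : M => h • m) Ω) (p x) v =
      pullback (fun m : M => h • m) Ω (g • p x)
        (fun i => mfderiv 𝓘(ℝ, E) 𝓘(ℝ, E) (fun m : M => g • m) (p x) (v i)) := rfl
  have h4 : pullback (fun m : M => g • m) Ω (p x) v = Ω (g • p x)
        (fun i => mfderiv 𝓘(ℝ, E) 𝓘(ℝ, E) (fun m : M => g • m) (p x) (v i)) := rfl
  rw [h2, pullback_comp_apply Ω (hd _ _) (hd _ _), h3, h1 _ hg.1, ← h4, hg.2, ← mul_assoc,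
    ← Real.exp_add]
  congr 2
  ring

/-- Non-degeneracy on a non-zero space gives a pair of vectors on which `Ω` does not vanish;
cancelling there compares the exponents. -/
theorem IsConformalLift.primitive_eq [Nontrivial E] (hΩ : Nondegenerate Ω) {g : G} {x y w : N}
    (hy : IsConformalLift Ω p lam g x y) (hw : IsConformalLift Ω p lam g x w) :
    lam y = lam w := by
  obtain ⟨e, he⟩ := exists_ne (0 : E)
  obtain ⟨e', he'⟩ : ∃ e' : E, Ω (p x) ![e, e'] ≠ 0 := by
    by_contra! hcon
    exact he (hΩ (p x) e hcon)
  have h := (hy.2 ![e, e']).symm.trans (hw.2 ![e, e'])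
  have h' := Real.exp_injective (mul_right_cancel₀ he' h)
  linarith

end ConformalLift

/-! ### Existence and continuity of the lifted action -/

section Lift

variable {E : Type*} [NormedAddCommGroup E] [NormedSpace ℝ E]
  {EG : Type*} [NormedAddCommGroup EG] [NormedSpace ℝ EG]
  {G : Type*} [TopologicalSpace G] [ChartedSpace EG G] [Group G] [LieGroup 𝓘(ℝ, EG) ∞ G]
  {M : Type u} [TopologicalSpace M] [ChartedSpace E M]
  [MulAction G M] [ContMDiffSMul 𝓘(ℝ, EG) 𝓘(ℝ, E) ∞ G M]
  {N : Type*} [TopologicalSpace N] [ChartedSpace E N]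
  {Ω : DForm E M 2} {θ : OneForm E M} {p : N → M} {lam : N → ℝ}

/-- Conformal lifts propagate along continuous lifts of orbits. -/
theorem IsConformalLift.of_section (hG : IsSpecialAction EG G Ω θ)
    (hp : IsLocalDiffeomorph 𝓘(ℝ, E) 𝓘(ℝ, E) ∞ p) (hlam : IsPrimitive p θ lam)
    {W : Set G} (hWo : IsOpen W) (hW : IsPreconnected W) {U : Set M} (hU : IsOpen U) {s : M → N}
    (hs : ContinuousOn s U) (hps : ∀ m ∈ U, p (s m) = m) {x : N} (hx : ∀ g ∈ W, g • p x ∈ U)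
    {g h : G} (hg : g ∈ W) (hh : h ∈ W) (hgx : IsConformalLift Ω p lam g x (s (g • p x))) :
    IsConformalLift Ω p lam h x (s (h • p x)) := by
  refine ⟨hps _ (hx h hh), fun v => ?_⟩
  have hsd : ∀ m ∈ U, MDifferentiableAt 𝓘(ℝ, E) 𝓘(ℝ, E) s m := fun m hm =>
    (contMDiffAt_of_lift hp (hs.continuousAt (hU.mem_nhds hm))
      (contMDiffAt_id.congr_of_eventuallyEq (by
        filter_upwards [hU.mem_nhds hm] with m' hm' using hps m' hm'))).mdifferentiableAt (by simp)
  have hlamd := hlam.smooth.mdifferentiable (by simp)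
  -- As `p ∘ s` is the identity near `m`, the function `lam ∘ s` is a local primitive of `θ`.
  have hprim : ∀ m ∈ U, mfderiv 𝓘(ℝ, E) 𝓘(ℝ) (lam ∘ s) m = θ m := by
    intro m hm
    have key : ∀ π : M → M, π =ᶠ[𝓝 m] id → p ∘ s = π →
        ((θ (π m)).comp (mfderiv 𝓘(ℝ, E) 𝓘(ℝ, E) π m) : E →L[ℝ] ℝ) = θ m := by
      intro π hπ _
      have h1 : (mfderiv 𝓘(ℝ, E) 𝓘(ℝ, E) π m : E →L[ℝ] E) = ContinuousLinearMap.id ℝ E :=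
        hπ.mfderiv_eq.trans mfderiv_id
      have h2 : ∀ a, a = m → ((θ a : E →L[ℝ] ℝ).comp (ContinuousLinearMap.id ℝ E)) = θ m := by
        rintro _ rfl; rfl
      exact (congrArg (fun l : E →L[ℝ] E => (θ (π m) : E →L[ℝ] ℝ).comp l) h1).trans
        (h2 _ hπ.self_of_nhds)
    exact (hlam.mfderiv_comp_eq rfl m (hp.mdifferentiable (by simp) _) (hsd m hm)).trans
      (key (p ∘ s) (by filter_upwards [hU.mem_nhds hm] with m' hm' using hps m' hm') rfl)
  -- The constant value on `W` is `e^{-lam x} Ω (p x) v`, as read off at `g`.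
  have h1 := eq_of_hasMFDerivAt_zero hWo hW (fun g' hg' => hasMFDerivAt_conf_pullback_smul hG g'
    (f := lam ∘ s) ((hlamd _).comp _ (hsd _ (hx g' hg'))) (hprim _ (hx g' hg')) v) hg hh
  simp only [Function.comp_apply, hgx.2 v] at h1
  have h2 : ∀ b, pullback (fun m : M => h • m) Ω (p x) v =
      Real.exp b * (Real.exp (-b) * pullback (fun m : M => h • m) Ω (p x) v) := fun b => by
    rw [← mul_assoc, ← Real.exp_add]; simp
  rw [h2 (lam (s (h • p x))), ← h1, ← mul_assoc, ← mul_assoc, ← Real.exp_add, ← Real.exp_add]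
  congr 2
  ring

/-- Having a lift is a locally constant property of `g`: over an evenly covered `U`, a section
through a lift at one point of a connected `W` gives lifts on all of `W`. Since `U` and `W` precede
the choice of lift, this works in both directions. -/
theorem exists_isConformalLift [ConnectedSpace G] (hG : IsSpecialAction EG G Ω θ)
    (hp : IsSmoothCovering (E := E) p) (hlam : IsPrimitive p θ lam) (x : N) (g : G) :
    ∃ y, IsConformalLift Ω p lam g x y := by
  have : LocallyConnectedSpace G := ChartedSpace.locallyConnectedSpace EG G
  have : ContinuousSMul G M := ContMDiffSMul.continuousSMul (I := 𝓘(ℝ, EG)) (I' := 𝓘(ℝ, E)) ∞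
  refine (isPreconnected_univ.induction₂ (fun g h : G => (∃ y, IsConformalLift Ω p lam g x y) ↔
    ∃ y, IsConformalLift Ω p lam h x y) (fun g₀ _ => ?_) (fun _ _ _ _ _ _ => Iff.trans)
    (fun _ _ _ _ => Iff.symm) (Set.mem_univ (1 : G)) (Set.mem_univ g)).1 ⟨x, .one x⟩
  obtain ⟨U, hU, hxU, hsec⟩ := exists_section_of_isCoveringMap hp.covering (g₀ • p x)
  have hc : Continuous fun g : G => g • p x := continuous_id.smul continuous_const
  obtain ⟨W, hWU, hWo, hg₀, hW⟩ := locallyConnectedSpace_iff_subsets_isOpen_isConnected.1 ‹_› g₀ _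
    (hc.continuousAt.preimage_mem_nhds (hU.mem_nhds hxU))
  have key : ∀ g ∈ W, ∀ h ∈ W, (∃ y, IsConformalLift Ω p lam g x y) →
      ∃ y, IsConformalLift Ω p lam h x y := by
    rintro g hg h hh ⟨y, hy⟩
    obtain ⟨s, hs, hps, hsy⟩ := hsec y (by rw [hy.1]; exact hWU hg)
    refine ⟨_, IsConformalLift.of_section hG hp.local_diffeo hlam hWo hW.isPreconnected hU hs hps
      (fun g' hg' => hWU hg') hg hh ?_⟩
    rw [← hy.1, hsy]
    exact hy
  filter_upwards [nhdsWithin_le_nhds (hWo.mem_nhds hg₀)] with h hh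
  exact ⟨key _ hg₀ _ hh, key _ hh _ hg₀⟩

/-- A map `G × N → N` obeying the laws of an action, which is continuous near the points `(1, x)`,
is continuous. -/
theorem continuous_of_eventually_continuousAt_one {G N : Type*} [TopologicalSpace G] [Group G]
    [IsTopologicalGroup G] [ConnectedSpace G] [TopologicalSpace N] {act : G → N → N}
    (h_one : ∀ x, act 1 x = x) (h_mul : ∀ g h x, act (g * h) x = act g (act h x))
    (hc : ∀ x, ∀ᶠ q in 𝓝 ((1 : G), x), ContinuousAt (fun q : G × N => act q.1 q.2) q) :
    Continuous fun q : G × N => act q.1 q.2 := by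
  have hslice : ∀ {g x}, ContinuousAt (fun q : G × N => act q.1 q.2) (g, x) →
      ContinuousAt (act g) x := fun {g x} h =>
    ContinuousAt.comp (f := fun y : N => (g, y)) h (by fun_prop)
  -- For `g` near `g₀`, both `act (g g₀⁻¹)` at `act g₀ x` and `act (g₀ g⁻¹)` at `act g x` are
  -- continuous, so continuity at `x` passes between `act g₀` and `act g`. The second uses
  -- continuity of the orbit map and the hypothesis on a whole neighbourhood of `(1, act g₀ x)`.
  have hsep : ∀ (g : G) (x : N), ContinuousAt (act g) x := by
    intro g x
    refine (isPreconnected_univ.induction₂ (fun g h : G => ContinuousAt (act g) x ↔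
      ContinuousAt (act h) x) (fun g₀ _ => ?_) (fun _ _ _ _ _ _ => Iff.trans)
      (fun _ _ _ _ => Iff.symm) (Set.mem_univ (1 : G)) (Set.mem_univ g)).1
      (continuousAt_id.congr (Filter.Eventually.of_forall fun y => (h_one y).symm))
    have h1 : Filter.Tendsto (fun g : G => (g * g₀⁻¹, act g₀ x)) (𝓝 g₀) (𝓝 (1, act g₀ x)) := by
      have : ContinuousAt (fun g : G => (g * g₀⁻¹, act g₀ x)) g₀ := by fun_prop
      simpa [ContinuousAt] using this
    have horb : Filter.Tendsto (fun g => act g x) (𝓝 g₀) (𝓝 (act g₀ x)) := by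
      have h2 := (hc (act g₀ x)).self_of_nhds.tendsto.comp h1
      simpa [Function.comp_def, ← h_mul] using h2
    have h2 : Filter.Tendsto (fun g : G => (g₀ * g⁻¹, act g x)) (𝓝 g₀) (𝓝 (1, act g₀ x)) := by
      have : ContinuousAt (fun g : G => g₀ * g⁻¹) g₀ := by fun_prop
      have h3 : Filter.Tendsto (fun g : G => g₀ * g⁻¹) (𝓝 g₀) (𝓝 1) := by
        simpa [ContinuousAt] using this
      exact h3.prodMk_nhds horb
    filter_upwards [nhdsWithin_le_nhds (h1.eventually (hc _)),
      nhdsWithin_le_nhds (h2.eventually (hc _))] with g hg hg'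
    constructor
    · intro h
      have h3 := ContinuousAt.comp (hslice hg) h
      simpa [Function.comp_def, ← h_mul] using h3
    · intro h
      have h3 := ContinuousAt.comp (hslice hg') h
      simpa [Function.comp_def, ← h_mul] using h3
  rw [continuous_iff_continuousAt]
  rintro ⟨g₀, x⟩
  have h1 : ContinuousAt (fun q : G × N => (q.1 * g₀⁻¹, act g₀ q.2)) (g₀, x) := by
    refine ContinuousAt.prodMk (by fun_prop) ?_
    exact ContinuousAt.comp (f := fun q : G × N => q.2) (hsep g₀ x) continuousAt_snd
  have h2 : ContinuousAt (fun q : G × N => act q.1 q.2) (g₀ * g₀⁻¹, act g₀ x) := by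
    rw [mul_inv_cancel]; exact (hc _).self_of_nhds
  have h3 := ContinuousAt.comp (f := fun q : G × N => (q.1 * g₀⁻¹, act g₀ q.2)) h2 h1
  simpa [Function.comp_def, ← h_mul] using h3

/-- A single local inverse `s` of `p` near `x` serves all `y` near `x`: starting from `s (p y) = y`
at `g = 1`, propagation over a connected `W` makes `s (g • p y)` a conformal lift, and uniqueness
identifies it with `act g y`. -/
theorem eventually_continuousAt_one [Nontrivial E] (hΩ : Nondegenerate Ω)
    (hG : IsSpecialAction EG G Ω θ)
    (hp : IsMinimalCovering θ p) (hlam : IsPrimitive p θ lam) {act : G → N → N}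
    (hact : ∀ g x, IsConformalLift Ω p lam g x (act g x)) (x : N) :
    ∀ᶠ q in 𝓝 ((1 : G), x), ContinuousAt (fun q : G × N => act q.1 q.2) q := by
  have : LocallyConnectedSpace G := ChartedSpace.locallyConnectedSpace EG G
  have : ContinuousSMul G M := ContMDiffSMul.continuousSMul (I := 𝓘(ℝ, EG)) (I' := 𝓘(ℝ, E)) ∞
  have hld := hp.1.local_diffeo
  have hpc : Continuous p := hp.1.covering.continuous
  set s := (hld x).localInverse
  have hc : Continuous fun q : G × N => q.1 • p q.2 := by fun_prop
  have hmem : (1 : G) • p x ∈ s.source := by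
    rw [one_smul]; exact (hld x).localInverse_mem_source
  have hU := hc.continuousAt.preimage_mem_nhds (x := (1, x)) (s.open_source.mem_nhds hmem)
  rw [nhds_prod_eq] at hU
  obtain ⟨W', hW', V, hV, hWV⟩ := Filter.mem_prod_iff.1 hU
  obtain ⟨W, hWW', hWo, h1W, hW⟩ :=
    locallyConnectedSpace_iff_subsets_isOpen_isConnected.1 ‹_› (1 : G) W' hW'
  have hV' : V ∩ s.target ∈ 𝓝 x :=
    Filter.inter_mem hV (s.open_target.mem_nhds (hld x).localInverse_mem_target)
  have hsc : ContinuousOn s s.source := (hld x).localInverse_contMDiffOn.continuousOn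
  have heq : ∀ q ∈ W ×ˢ (V ∩ s.target), act q.1 q.2 = s (q.1 • p q.2) := by
    rintro ⟨g, y⟩ ⟨hg, hy, hyt⟩
    have h1 : IsConformalLift Ω p lam g y (s (g • p y)) :=
      IsConformalLift.of_section hG hld hlam hWo hW.isPreconnected s.open_source hsc
        (fun m hm => (hld x).localInverse_right_inv hm)
        (fun g' hg' => hWV (Set.mk_mem_prod (hWW' hg') hy)) h1W hg (by
          rw [one_smul, (hld x).localInverse_left_inv hyt]
          exact .one y)
    exact hp.eq_of_primitive_eq hlam ((hact g y).1.trans h1.1.symm)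
      ((hact g y).primitive_eq hΩ h1)
  have hnhds : W ×ˢ (V ∩ s.target) ∈ 𝓝 ((1 : G), x) := prod_mem_nhds (hWo.mem_nhds h1W) hV'
  filter_upwards [eventually_mem_nhds_iff.2 hnhds] with q hq
  have hq' := mem_of_mem_nhds hq
  have h1 : ContinuousAt (fun q : G × N => s (q.1 • p q.2)) q :=
    ContinuousAt.comp (g := s) (f := fun q : G × N => q.1 • p q.2)
      (hsc.continuousAt (s.open_source.mem_nhds
        (hWV (Set.mk_mem_prod (hWW' hq'.1) hq'.2.1)))) hc.continuousAt
  exact h1.congr (by filter_upwards [hq] with q' hq' using (heq q' hq').symm)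

end Lift

end LCS

/-! ### The lifted symplectic action -/

open scoped Manifold ContDiff in
open LCS in
theorem lemma4p5
    {E : Type*} [NormedAddCommGroup E] [NormedSpace ℝ E] [FiniteDimensional ℝ E]
    {EG : Type*} [NormedAddCommGroup EG] [NormedSpace ℝ EG] [FiniteDimensional ℝ EG]
    -- a connected Lie group
    {G : Type*} [TopologicalSpace G] [ChartedSpace EG G] [Group G]
    [LieGroup 𝓘(ℝ, EG) ∞ G] [ConnectedSpace G]
    -- a connected lcs manifold
    {M : Type*} [TopologicalSpace M] [ChartedSpace E M] [IsManifold 𝓘(ℝ, E) ∞ M]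
    [T2Space M] [SecondCountableTopology M] [ConnectedSpace M]
    (Ω : DForm E M 2) (θ : OneForm E M) (hΩ : IsLCS Ω) (hθ : IsLeeForm Ω θ)
    -- a smooth special lcs action
    [MulAction G M] [ContMDiffSMul 𝓘(ℝ, EG) 𝓘(ℝ, E) ∞ G M]
    (hG : IsSpecialAction EG G Ω θ)
    -- the minimal covering, with its symplectic form `Ω₀ = e^{-lam} p^* Ω`
    {Mh : Type*} [TopologicalSpace Mh] [ChartedSpace E Mh] [IsManifold 𝓘(ℝ, E) ∞ Mh]
    (p : Mh → M) (hp : IsMinimalCovering θ p)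
    (lam : Mh → ℝ) (hlam : IsPrimitive p θ lam)
    (Ω₀ : DForm E Mh 2) (hΩ₀ : Ω₀ = conf lam (pullback p Ω)) :
    ∃ _ : MulAction G Mh,
      ContMDiffSMul 𝓘(ℝ, EG) 𝓘(ℝ, E) ∞ G Mh ∧
      (∀ (g : G) (x : Mh), p (g • x) = g • p x) ∧
      ∀ g : G, pullback (fun x : Mh => g • x) Ω₀ = Ω₀ := by
  -- Positive dimension is needed for `Ω` to determine the conformal factor.
  have : Nontrivial E := Module.nontrivial_of_finrank_pos (R := ℝ) (by
    have := hΩ.two_lt_dim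
    omega)
  have : IsTopologicalGroup G := topologicalGroup_of_lieGroup 𝓘(ℝ, EG) ∞
  have hd : ∀ (g : G) (m : M), MDifferentiableAt 𝓘(ℝ, E) 𝓘(ℝ, E) (fun m : M => g • m) m :=
    fun g m => (ContMDiffSMul.contMDiff_const_smul (I := 𝓘(ℝ, EG)) (I' := 𝓘(ℝ, E)) (n := ∞)
      g).mdifferentiableAt (by simp)
  have hpd := hp.1.local_diffeo.mdifferentiable (by simp)
  choose act hact using fun (g : G) (x : Mh) => exists_isConformalLift hG hp.1 hlam x g
  have huniq : ∀ {g : G} {x y : Mh}, IsConformalLift Ω p lam g x y → act g x = y :=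
    fun {g x y} hy => hp.eq_of_primitive_eq hlam ((hact g x).1.trans hy.1.symm)
      ((hact g x).primitive_eq hΩ.nondegenerate hy)
  have h_one : ∀ x, act 1 x = x := fun x => huniq (.one x)
  have h_mul : ∀ g h x, act (g * h) x = act g (act h x) := fun g h x =>
    huniq ((hact h x).mul hd (hact g (act h x)))
  have hcont := continuous_of_eventually_continuousAt_one h_one h_mul
    (eventually_continuousAt_one hΩ.nondegenerate hG hp hlam hact)
  have hsmooth : ContMDiff (𝓘(ℝ, EG).prod 𝓘(ℝ, E)) 𝓘(ℝ, E) ∞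
      (fun q : G × Mh => act q.1 q.2) := fun q => by
    refine contMDiffAt_of_lift hp.1.local_diffeo hcont.continuousAt ?_
    simp only [(hact _ _).1]
    exact contMDiffAt_fst.smul (I' := 𝓘(ℝ, E))
      (hp.1.local_diffeo.contMDiff.contMDiffAt.comp q contMDiffAt_snd)
  have hactd : ∀ g, MDifferentiable 𝓘(ℝ, E) 𝓘(ℝ, E) (act g) := fun g =>
    (hsmooth.comp (contMDiff_const.prodMk contMDiff_id)).mdifferentiable (by simp)
  let inst : MulAction G Mh := { smul := act, one_smul := h_one, mul_smul := h_mul }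
  refine ⟨inst, ⟨hsmooth⟩,
    fun g x => (hact g x).1, fun g => ?_⟩
  change pullback (act g) Ω₀ = Ω₀
  subst hΩ₀
  funext x
  have h1 : p ∘ act g = (fun m : M => g • m) ∘ p := funext fun y => (hact g y).1
  have h2 : pullback (act g) (conf lam (pullback p Ω)) x =
      Real.exp (-lam (act g x)) • pullback (act g) (pullback p Ω) x :=
    pullback_smul_apply (fun y => Real.exp (-lam y)) _ _ _
  rw [h2, ← pullback_comp_apply Ω (hpd _) (hactd g x), h1, pullback_comp_apply Ω (hd _ _) (hpd x)]
  ext v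
  have h3 := (hact g x).2 (fun i => mfderiv 𝓘(ℝ, E) 𝓘(ℝ, E) p x (v i))
  change Real.exp (-lam (act g x)) * pullback (fun m : M => g • m) Ω (p x)
    (fun i => mfderiv 𝓘(ℝ, E) 𝓘(ℝ, E) p x (v i)) = Real.exp (-lam x) * Ω (p x)
    (fun i => mfderiv 𝓘(ℝ, E) 𝓘(ℝ, E) p x (v i))
  -- The conformal factor `e^{lam (g x) - lam x}` turns `e^{-lam (g x)}` into `e^{-lam x}`.
  rw [h3, ← mul_assoc, ← Real.exp_add]
  congr 2
  ring
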